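/- \textbf{Theorem.} If one-way puzzles exist, then state puzzles exist. Here the notions are as follows. A function $f:\mathbb N\to\mathbb R$ is \emph{negligible} if for every $c\in\mathbb N$ there is $N$ with $f(n)<n^{-c}$ for all $n>N$. A \emph{quantum polynomial-time (QPT) algorithm} on input $1^n$ is a quantum circuit over the gate set $\{H,T,\mathrm{CNOT}\}$, whose description and whose register boundaries are computed from $1^n$ by a deterministic polynomial-time Turing machine, and which is run on $|0\cdots0\rangle$; its wires are divided into output registers and a discarded register. An \emph{adversary} $\mathcal A=\{\mathcal A_n\}$ is a (non-uniform) family of polynomial-size quantum circuits over the same gate set, which take as input a classical string $s$, an advice state $|\tau_n\rangle$ (an arbitrary pure state on polynomially many qubits) and ancillas $|0\cdots0\rangle$, and output the state of a designated register, the other wires being discarded. A \emph{one-way puzzle} is a pair $(\mathsf{Samp},\mathsf{Ver})$, where $\mathsf{Samp}(1^n)$ is a QPT algorithm whose two output registers are measured in the computational basis to give a puzzle $s\in\{0,1\}^{\ell(n)}$ and a key $k\in\{0,1\}^{\kappa(n)}$, and $\mathsf{Ver}$ is an arbitrary (not necessarily efficient) Boolean function of the puzzle and the key, such that \begin{itemize}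 \item (correctness) $1-\Pr_{(s,k)\leftarrow\mathsf{Samp}(1^n)}[\mathsf{Ver}(s,k)=\top]$ is negligible in $n$; \item (security) for every adversary $\mathcal A$ and every advice ensemble $\{|\tau_n\rangle\}_n$, the probability $\Pr_{(s,k)\leftarrow\mathsf{Samp}(1^n)}[\mathsf{Ver}(s,\mathcal A(|\tau_n\rangle,s))=\top]$ is negligible in $n$, where $\mathcal A$ outputs $\kappa(n)$ qubits that are measured in the computational basis. \end{itemize} A \emph{state puzzle} is a QPT algorithm $\mathcal G(1^n)$ that outputs a classical-quantum state $(s,|\psi_s\rangle)$, i.e. measuring its first output register gives a string $s$, and for every $s$ of positive probability the second output register is then (after tracing out the discarded register) in a pure state $|\psi_s\rangle$ determined by $n$ and $s$, such that for every adversary $\mathcal A$ and every advice ensemble $\{|\tau_n\rangle\}_n$ the quantity $$\mathop{\mathbb E}_{(s,|\psi_s\rangle)\leftarrow\mathcal G(1^n),\ \rho\leftarrow\mathcal A(|\tau_n\rangle,s)}\big[\mathrm{Tr}(|\psi_s\rangle\langle\psi_s|\,\rho)\big]$$ is negligible in $n$. -/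

import Mathlib

noncomputable section

namespace QCrypt

/-- A function `f : ℕ → ℝ` is negligible if for every constant `c` it is eventually below `n⁻ᶜ`. -/
def IsNegligible (f : ℕ → ℝ) : Prop :=
  ∀ c : ℕ, ∃ N : ℕ, ∀ n : ℕ, N < n → f n < ((n : ℝ) ^ c)⁻¹

/-! ### Qubits, gates and circuits -/

/-- Bit strings of length `N`. -/
abbrev BitStr (N : ℕ) : Type := Fin N → Bool

/-- A vector of `(ℂ²)^{⊗N}`, given by its amplitudes in the computational basis. -/
abbrev Ket (N : ℕ) : Type := BitStr N → ℂ

/-- Operators on `N` qubits, as matrices in the computational basis. -/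
abbrev QOp (N : ℕ) : Type := Matrix (BitStr N) (BitStr N) ℂ

/-- A pure state is a unit vector. -/
def Ket.IsState {N : ℕ} (φ : Ket N) : Prop := ∑ x, ‖φ x‖ ^ 2 = 1

/-- The universal gate set `{H, T, CNOT}`, applied to wires of an `N`-qubit register. -/
inductive Gate (N : ℕ) : Type
  | hadamard (i : Fin N) : Gate N
  | phaseT (i : Fin N) : Gate N
  | cnot (control target : Fin N) (h : control ≠ target) : Gate N

/-- The action of a gate on an `N`-qubit vector:
`H|b⟩ = (|0⟩ + (-1)^b |1⟩)/√2`, `T|b⟩ = e^{iπb/4}|b⟩`, `CNOT|c,t⟩ = |c, t ⊕ c⟩`. -/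
def Gate.apply {N : ℕ} : Gate N → Ket N → Ket N
  | .hadamard i, φ => fun x =>
      ((Real.sqrt 2 : ℝ) : ℂ)⁻¹ *
        ∑ b : Bool, (if (x i && b) = true then (-1 : ℂ) else 1) * φ (Function.update x i b)
  | .phaseT i, φ => fun x =>
      (if x i = true then Complex.exp (Complex.I * (Real.pi / 4 : ℝ)) else 1) * φ x
  | .cnot c t _, φ => fun x => φ (Function.update x t (xor (x t) (x c)))

/-- A (unitary) quantum circuit on `N` qubits: a list of gates, applied from left to right. -/
abbrev Circuit (N : ℕ) : Type := List (Gate N)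

/-- The vector obtained by running a circuit on a given input vector. -/
def Circuit.run {N : ℕ} (C : Circuit N) (φ : Ket N) : Ket N :=
  C.foldl (fun χ g => g.apply χ) φ

/-- The all-zero basis vector `|0…0⟩`. -/
def zeroKet (N : ℕ) : Ket N := fun x => if x = fun _ => false then 1 else 0

/-! ### Uniformity -/

/-- A self-delimiting code for a number: `i` ones followed by a zero. -/
def encodeWire (i : ℕ) : List Bool := List.replicate i true ++ [false]

/-- The description of a gate: a tag followed by the wires. -/
def Gate.encode {N : ℕ} : Gate N → List Bool
  | .hadamard i => [false, false] ++ encodeWire i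
  | .phaseT i => [false, true] ++ encodeWire i
  | .cnot c t _ => [true] ++ encodeWire c ++ encodeWire t

/-- The description of a circuit: the concatenation of the descriptions of its gates. -/
def Circuit.encode {N : ℕ} (C : Circuit N) : List Bool := C.flatMap Gate.encode

/-- The unary representation of a number. -/
def unary (n : ℕ) : List Bool := List.replicate n true

/-- The bit string `f n` can be computed from `1ⁿ` by a deterministic Turing machine in time
polynomial in `n`. -/
def PolyTimeString (f : ℕ → List Bool) : Prop :=
  Nonempty (Turing.TM2ComputableInPolyTime unary id f)

/-- The number `f n` can be computed, in unary, from `1ⁿ` by a deterministic Turing machine in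
time polynomial in `n`. -/
def PolyTimeNat (f : ℕ → ℕ) : Prop :=
  Nonempty (Turing.TM2ComputableInPolyTime unary unary f)

/-! ### Quantum polynomial-time generators -/

/-- A (uniform) quantum polynomial-time algorithm that on input `1ⁿ` produces two output
registers. A circuit, printed by a polynomial-time Turing machine, is run on `|0…0⟩`. Its wires
consist, in this order, of a first output register (`fstLen n` qubits), a second output register
(`sndLen n` qubits) and a register of junk (`junkLen n` qubits) that is discarded.
The positions at which the registers end are polynomial-time computable as well. -/
structure QPTGenerator where
  width : ℕ → ℕ
  fstLen : ℕ → ℕ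
  sndLen : ℕ → ℕ
  junkLen : ℕ → ℕ
  width_eq : ∀ n, width n = fstLen n + sndLen n + junkLen n
  circuit : ∀ n, Circuit (width n)
  uniform_circuit : PolyTimeString fun n => (circuit n).encode
  uniform_width : PolyTimeNat width
  uniform_fst : PolyTimeNat fstLen
  uniform_snd : PolyTimeNat fun n => fstLen n + sndLen n

namespace QPTGenerator

variable (G : QPTGenerator) (n : ℕ)

/-- The final amplitude of the basis vector `|s⟩|k⟩|z⟩` (first output, second output, junk). -/
def amp (s : BitStr (G.fstLen n)) (k : BitStr (G.sndLen n)) (z : BitStr (G.junkLen n)) : ℂ :=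
  (G.circuit n).run (zeroKet (G.width n))
    (Fin.append (Fin.append s k) z ∘ Fin.cast (G.width_eq n))

/-- The probability of the outcome `(s, k)` when both output registers are measured in the
computational basis. -/
def jointProb (s : BitStr (G.fstLen n)) (k : BitStr (G.sndLen n)) : ℝ :=
  ∑ z, ‖G.amp n s k z‖ ^ 2

/-- The probability of the outcome `s` when the first output register is measured in the
computational basis. -/
def fstProb (s : BitStr (G.fstLen n)) : ℝ := ∑ k, G.jointProb n s k

/-- The unnormalised state of the second output register (the junk being traced out) after the
first output register has been measured with outcome `s`; its trace is `fstProb s`. Thus the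
classical-quantum output of the algorithm is `∑ s, |s⟩⟨s| ⊗ residual s`. -/
def residual (s : BitStr (G.fstLen n)) : QOp (G.sndLen n) :=
  fun y y' => ∑ z, G.amp n s y z * star (G.amp n s y' z)

end QPTGenerator

/-! ### Adversaries -/

/-- A non-uniform family of polynomial-size quantum circuits `{Aₙ}`. The input wires of `Aₙ` hold
a classical string of `inLen n` bits, an advice state of `adviceLen n` qubits and `ancillaLen n`
qubits in state `|0⟩`. At the end the first `outLen n` wires are the output, the other
`discardLen n` wires are discarded. -/
structure PolySizeAdversary (inLen outLen : ℕ → ℕ) where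
  adviceLen : ℕ → ℕ
  ancillaLen : ℕ → ℕ
  discardLen : ℕ → ℕ
  width_eq : ∀ n, inLen n + adviceLen n + ancillaLen n = outLen n + discardLen n
  circuit : ∀ n, Circuit (inLen n + adviceLen n + ancillaLen n)
  poly_size : ∃ p : Polynomial ℕ, ∀ n,
    (inLen n + adviceLen n + ancillaLen n) + (circuit n).length ≤ p.eval n

/-- A quantum advice ensemble `{|τₙ⟩}`: a pure state of `len n` qubits for every `n`. -/
structure AdviceEnsemble (len : ℕ → ℕ) where
  ket : ∀ n, Ket (len n)
  isState : ∀ n, (ket n).IsState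

/-- The vector `|s⟩|τ⟩|0…0⟩`. -/
def inputKet {a b c : ℕ} (s : BitStr a) (τ : Ket b) : Ket (a + b + c) := fun x =>
  if (∀ i : Fin a, x (Fin.castAdd c (Fin.castAdd b i)) = s i) ∧
      (∀ i : Fin c, x (Fin.natAdd (a + b) i) = false) then
    τ fun i => x (Fin.castAdd c (Fin.natAdd a i))
  else 0

namespace PolySizeAdversary

variable {inLen outLen : ℕ → ℕ} (A : PolySizeAdversary inLen outLen)
  (τ : AdviceEnsemble A.adviceLen) (n : ℕ) (s : BitStr (inLen n))

/-- The final amplitude of `|y⟩|z⟩` (output, discarded wires) in the run on advice `τ` and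
input `s`. -/
def amp (y : BitStr (outLen n)) (z : BitStr (A.discardLen n)) : ℂ :=
  (A.circuit n).run (inputKet s (τ.ket n)) (Fin.append y z ∘ Fin.cast (A.width_eq n))

/-- The mixed state `A(|τ⟩, s)` output by the adversary. -/
def output : QOp (outLen n) :=
  fun y y' => ∑ z, A.amp τ n s y z * star (A.amp τ n s y' z)

/-- The probability that measuring the output of the adversary in the computational basis
gives the string `y`. -/
def outputProb (y : BitStr (outLen n)) : ℝ := (A.output τ n s y y).re

end PolySizeAdversary

/-- `⟨ψ|ρ|ψ⟩ = Tr(|ψ⟩⟨ψ| ρ)`, the overlap of `ρ` with the pure state `ψ`. -/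
def overlap {N : ℕ} (ψ : Ket N) (ρ : QOp N) : ℝ :=
  (Matrix.trace (Matrix.vecMulVec ψ (star ψ) * ρ)).re

/-! ### One-way puzzles and state puzzles -/

/-- A one-way puzzle: `Samp` is a quantum polynomial-time algorithm whose two output registers are
measured to give a puzzle `s` and a key `k`, and `Ver` is an arbitrary Boolean function of puzzles
and keys. -/
structure IsOneWayPuzzle (Samp : QPTGenerator)
    (Ver : ∀ n, BitStr (Samp.fstLen n) → BitStr (Samp.sndLen n) → Bool) : Prop where
  /-- `Pr_{(s,k) ← Samp(1ⁿ)} [Ver(s,k) = ⊤] = 1 - negl(n)` -/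
  correct : IsNegligible fun n =>
    1 - ∑ s, ∑ k, if Ver n s k = true then Samp.jointProb n s k else 0
  /-- `Pr_{(s,k) ← Samp(1ⁿ)} [Ver(s, A(|τ⟩,s)) = ⊤] = negl(n)` -/
  secure : ∀ (A : PolySizeAdversary Samp.fstLen Samp.sndLen) (τ : AdviceEnsemble A.adviceLen),
    IsNegligible fun n =>
      ∑ s, Samp.fstProb n s * ∑ k, if Ver n s k = true then A.outputProb τ n s k else 0

/-- A state puzzle: a quantum polynomial-time algorithm `G` that outputs a classical string `s`
(its first register, measured) together with a pure state `|ψ_s⟩` (its second register), such that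
no adversary, given `s`, synthesizes a state with noticeable expected overlap with `|ψ_s⟩`. -/
structure IsStatePuzzle (G : QPTGenerator)
    (ψ : ∀ n, BitStr (G.fstLen n) → Ket (G.sndLen n)) : Prop where
  isState : ∀ n s, (ψ n s).IsState
  /-- The output of `G(1ⁿ)` is `(s, |ψ_s⟩)`, with `s` distributed according to `fstProb`. -/
  output_eq : ∀ n s,
    G.residual n s = (G.fstProb n s : ℂ) • Matrix.vecMulVec (ψ n s) (star (ψ n s))
  /-- `E_{(s,|ψ_s⟩) ← G(1ⁿ), ρ ← A(|τ⟩,s)} [Tr(|ψ_s⟩⟨ψ_s| ρ)] ≤ negl(n)` -/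
  secure : ∀ (A : PolySizeAdversary G.fstLen G.sndLen) (τ : AdviceEnsemble A.adviceLen),
    IsNegligible fun n => ∑ s, G.fstProb n s * overlap (ψ n s) (A.output τ n s)

end QCrypt

end

namespace QCrypt

open Finset

/-! ### Negligible functions -/

/-! Let the state puzzle run the circuit of `Samp` and hand out the junk together with the key
(`purify`). Nothing is traced out any more, so each outcome `s` leaves a pure state `ψ_s`, the
normalised superposition of all `|k⟩|z⟩` compatible with `s`.

An adversary that synthesizes `ψ_s` also breaks the puzzle: drop the junk part of its output and
measure the rest (`truncate`). By correctness `ψ_s` is concentrated, for typical `s`, on keys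
accepted by `Ver`. Split the inner product of `ψ_s` with the adversary's output into accepted and
rejected keys; `(x + y)² ≤ 2x² + 2y²` and Cauchy–Schwarz bound the overlap by twice the probability
that the measured key is accepted plus twice the rejected mass of `ψ_s` (`sum_norm_inner_sq_le`,
`QPTGenerator.fstProb_mul_overlap_le`). Averaged over `s`, these are the success probability against
the puzzle and its correctness error, both negligible. `Ver` enters only the analysis, so it need
not be efficient. Unitarity is needed only to know that total masses are one. -/

theorem IsNegligible.of_le_two_mul_add {f g h : ℕ → ℝ} (hg : IsNegligible g)
    (hh : IsNegligible h) (hf : ∀ n, f n ≤ 2 * g n + 2 * h n) : IsNegligible f := by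
  intro c
  obtain ⟨N₁, h₁⟩ := hg (c + 1)
  obtain ⟨N₂, h₂⟩ := hh (c + 1)
  -- The spare power of `n` in `c + 1` absorbs the factor `4 = 2 + 2` once `n > 4`.
  refine ⟨max 4 (max N₁ N₂), fun n hn => ?_⟩
  simp only [max_lt_iff] at hn
  have hn4 : (4 : ℝ) < n := by exact_mod_cast hn.1
  have hn0 : (0 : ℝ) < n := by linarith
  have key : 4 * ((n : ℝ) ^ (c + 1))⁻¹ ≤ ((n : ℝ) ^ c)⁻¹ := by
    rw [pow_succ, mul_inv, mul_left_comm]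
    refine mul_le_of_le_one_right (by positivity) ?_
    rw [← div_eq_mul_inv, div_le_one hn0]
    exact hn4.le
  linarith [hf n, h₁ n hn.2.1, h₂ n hn.2.2]

/-! ### Circuits preserve the norm -/

theorem sum_norm_sq_phaseT {N : ℕ} (i : Fin N) (φ : Ket N) :
    ∑ x, ‖(Gate.phaseT i).apply φ x‖ ^ 2 = ∑ x, ‖φ x‖ ^ 2 := by
  refine sum_congr rfl fun x _ => ?_
  have h : ‖Complex.exp (Complex.I * (Real.pi / 4 : ℝ))‖ = 1 := by
    rw [mul_comm]
    exact Complex.norm_exp_ofReal_mul_I _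
  simp only [Gate.apply]
  split_ifs
  · rw [norm_mul, h, one_mul]
  · rw [one_mul]

theorem sum_norm_sq_cnot {N : ℕ} (c t : Fin N) (h : c ≠ t) (φ : Ket N) :
    ∑ x, ‖(Gate.cnot c t h).apply φ x‖ ^ 2 = ∑ x, ‖φ x‖ ^ 2 := by
  have hinv : Function.Involutive fun x : BitStr N =>
      Function.update x t (xor (x t) (x c)) := by
    intro x
    simp [Function.update_of_ne h]
  exact Equiv.sum_comp (hinv.toPerm _) fun x => ‖φ x‖ ^ 2

/-- The gate mixes only the two amplitudes at `x` and at `x` with bit `i` flipped, and on such a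
pair the claim is the parallelogram law. Doubling the sum allows pairing without choosing
representatives. -/
theorem sum_norm_sq_hadamard {N : ℕ} (i : Fin N) (φ : Ket N) :
    ∑ x, ‖(Gate.hadamard i).apply φ x‖ ^ 2 = ∑ x, ‖φ x‖ ^ 2 := by
  have hinv : Function.Involutive fun x : BitStr N => Function.update x i (!x i) := by
    intro x
    simp
  have hflip (F : BitStr N → ℝ) :
      2 * ∑ x, F x = ∑ x, (F x + F (Function.update x i (!x i))) := by
    have := Equiv.sum_comp (hinv.toPerm _) F
    simp only [Function.Involutive.coe_toPerm] at this
    rw [sum_add_distrib, this, two_mul]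
  have hpar (a b : ℂ) : ‖((Real.sqrt 2 : ℝ) : ℂ)⁻¹ * (-a + b)‖ ^ 2 +
      ‖((Real.sqrt 2 : ℝ) : ℂ)⁻¹ * (a + b)‖ ^ 2 = ‖a‖ ^ 2 + ‖b‖ ^ 2 := by
    have h2 : ‖((Real.sqrt 2 : ℝ) : ℂ)⁻¹‖ ^ 2 = 1 / 2 := by
      rw [norm_inv, Complex.norm_real, inv_pow, Real.norm_eq_abs, sq_abs, Real.sq_sqrt] <;>
        norm_num
    have hp := parallelogram_law_with_norm ℝ a b
    have hn : ‖-a + b‖ = ‖a - b‖ := by rw [← norm_neg]; congr 1; ring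
    rw [norm_mul, norm_mul, mul_pow, mul_pow, h2, hn]
    linarith
  have key : 2 * ∑ x, ‖(Gate.hadamard i).apply φ x‖ ^ 2 = 2 * ∑ x, ‖φ x‖ ^ 2 := by
    rw [hflip, hflip]
    refine sum_congr rfl fun x _ => ?_
    have hself : φ x = φ (Function.update x i (x i)) := by rw [Function.update_eq_self]
    rw [hself]
    cases hx : x i
    · have := hpar (φ (Function.update x i true)) (φ (Function.update x i false))
      simp only [Gate.apply, hx, Fintype.sum_bool, Function.update_self, Function.update_idem,
        Bool.and_true, Bool.and_false, Bool.not_false, Bool.false_eq_true,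
        if_true, if_false, neg_mul, one_mul]
      linarith
    · have := hpar (φ (Function.update x i true)) (φ (Function.update x i false))
      simp only [Gate.apply, hx, Fintype.sum_bool, Function.update_self, Function.update_idem,
        Bool.and_true, Bool.and_false, Bool.not_true, Bool.false_eq_true,
        if_true, if_false, neg_mul, one_mul]
      linarith
  linarith

theorem Gate.sum_norm_sq_apply {N : ℕ} (g : Gate N) (φ : Ket N) :
    ∑ x, ‖g.apply φ x‖ ^ 2 = ∑ x, ‖φ x‖ ^ 2 := by
  cases g with
  | hadamard i => exact sum_norm_sq_hadamard i φ
  | phaseT i => exact sum_norm_sq_phaseT i φ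
  | cnot c t h => exact sum_norm_sq_cnot c t h φ

theorem Circuit.sum_norm_sq_run {N : ℕ} (C : Circuit N) (φ : Ket N) :
    ∑ x, ‖C.run φ x‖ ^ 2 = ∑ x, ‖φ x‖ ^ 2 := by
  induction C generalizing φ with
  | nil => rfl
  | cons g C ih => exact (ih (g.apply φ)).trans (g.sum_norm_sq_apply φ)

/-! ### Sums over concatenated bit strings -/

theorem sum_append {M : Type*} [AddCommMonoid M] {a b : ℕ} (f : BitStr (a + b) → M) :
    ∑ x, f x = ∑ y : BitStr a, ∑ z : BitStr b, f (Fin.append y z) := by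
  rw [← (Fin.appendEquiv a b).sum_comp f, Fintype.sum_prod_type]
  rfl

theorem sum_append_cast {M : Type*} [AddCommMonoid M] {N a b : ℕ} (h : N = a + b)
    (f : BitStr N → M) :
    ∑ x, f x = ∑ y : BitStr a, ∑ z : BitStr b, f (Fin.append y z ∘ Fin.cast h) := by
  subst h
  exact sum_append f

theorem sum_norm_sq_zeroKet (N : ℕ) : ∑ x, ‖zeroKet N x‖ ^ 2 = 1 := by
  rw [sum_eq_single fun _ => false] <;> simp +contextual [zeroKet]

theorem inputKet_append {a b c : ℕ} (s : BitStr a) (τ : Ket b) (x : BitStr a) (y : BitStr b)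
    (z : BitStr c) : inputKet s τ (Fin.append (Fin.append x y) z) =
      if x = s ∧ z = fun _ => false then τ y else 0 := by
  simp [inputKet, funext_iff]

theorem sum_norm_sq_inputKet {a b c : ℕ} (s : BitStr a) (τ : Ket b) :
    ∑ x, ‖(inputKet s τ : Ket (a + b + c)) x‖ ^ 2 = ∑ y, ‖τ y‖ ^ 2 := by
  rw [sum_append, sum_append, sum_eq_single s]
  · refine sum_congr rfl fun y _ => ?_
    rw [sum_eq_single fun _ => false]
    · simp [inputKet_append]
    · intro z _ hz
      simp [inputKet_append, hz]
    · simp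
  · intro x _ hx
    simp [inputKet_append, hx]
  · simp

/-! ### Probabilities of a generator -/

namespace QPTGenerator

variable (G : QPTGenerator) (n : ℕ)

theorem sum_fstProb : ∑ s, G.fstProb n s = 1 := by
  rw [← sum_norm_sq_zeroKet (G.width n), ← (G.circuit n).sum_norm_sq_run,
    sum_append_cast (G.width_eq n), sum_append]
  rfl

theorem jointProb_nonneg (s : BitStr (G.fstLen n)) (k : BitStr (G.sndLen n)) :
    0 ≤ G.jointProb n s k :=
  sum_nonneg fun _ _ => sq_nonneg _

theorem fstProb_nonneg (s : BitStr (G.fstLen n)) : 0 ≤ G.fstProb n s :=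
  sum_nonneg fun _ _ => G.jointProb_nonneg n s _

/-- The generator that hands out its junk as part of the second output register. -/
def purify : QPTGenerator where
  width := G.width
  fstLen := G.fstLen
  sndLen n := G.sndLen n + G.junkLen n
  junkLen _ := 0
  width_eq n := by rw [G.width_eq n]; omega
  circuit := G.circuit
  uniform_circuit := G.uniform_circuit
  uniform_width := G.uniform_width
  uniform_fst := G.uniform_fst
  uniform_snd := by
    -- The enlarged second register ends at the last wire, so its boundary is the width.
    have h : (fun n => G.fstLen n + (G.sndLen n + G.junkLen n)) = G.width := by
      funext n
      rw [G.width_eq n, add_assoc]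
    rw [h]
    exact G.uniform_width

theorem purify_amp_append (s : BitStr (G.fstLen n)) (k : BitStr (G.sndLen n))
    (z : BitStr (G.junkLen n)) (e : BitStr 0) :
    G.purify.amp n s (Fin.append k z) e = G.amp n s k z := by
  have h : Fin.append (Fin.append s (Fin.append k z)) e ∘ Fin.cast (G.purify.width_eq n) =
      Fin.append (Fin.append s k) z ∘ Fin.cast (G.width_eq n) := by
    rw [Fin.append_assoc s k z, Fin.append_right_nil _ e rfl]
    rfl
  exact congrArg ((G.circuit n).run (zeroKet (G.width n))) h

theorem purify_fstProb (s : BitStr (G.fstLen n)) : G.purify.fstProb n s = G.fstProb n s := by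
  refine (sum_append (a := G.sndLen n) (b := G.junkLen n) _).trans ?_
  refine sum_congr rfl fun k _ => sum_congr rfl fun z _ => ?_
  refine (Fintype.sum_unique (ι := BitStr 0) _).trans ?_
  rw [purify_amp_append]

/-- The amplitudes of the second output register of the purified generator, given `s`. -/
noncomputable def purifyAmp (s : BitStr (G.fstLen n)) : Ket (G.sndLen n + G.junkLen n) :=
  fun y => G.purify.amp n s y Fin.elim0

theorem purifyAmp_append (s : BitStr (G.fstLen n)) (k : BitStr (G.sndLen n))
    (z : BitStr (G.junkLen n)) : G.purifyAmp n s (Fin.append k z) = G.amp n s k z :=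
  G.purify_amp_append n s k z _

theorem sum_norm_sq_purifyAmp (s : BitStr (G.fstLen n)) :
    ∑ y, ‖G.purifyAmp n s y‖ ^ 2 = G.fstProb n s := by
  rw [sum_append]
  simp only [purifyAmp_append]
  rfl

/-- The junk register is empty, so the partial trace has a single term and the residual has rank at
most one; this is where purity comes from. -/
theorem purify_residual (s : BitStr (G.fstLen n)) :
    G.purify.residual n s = Matrix.vecMulVec (G.purifyAmp n s) (star (G.purifyAmp n s)) := by
  funext y y'
  refine (Fintype.sum_unique (ι := BitStr 0) _).trans ?_
  exact congrArg (fun e => G.purify.amp n s y e * star (G.purify.amp n s y' e))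
    (Subsingleton.elim _ Fin.elim0)

/-- The state of the second output register of the purified generator, given `s`: the normalised
amplitudes, or an arbitrary state if `s` has probability zero. -/
noncomputable def purifyState (s : BitStr (G.fstLen n)) : Ket (G.sndLen n + G.junkLen n) :=
  if G.fstProb n s = 0 then zeroKet _
  else fun y => ((Real.sqrt (G.fstProb n s) : ℝ) : ℂ)⁻¹ * G.purifyAmp n s y

theorem purifyState_isState (s : BitStr (G.fstLen n)) : (G.purifyState n s).IsState := by
  unfold Ket.IsState purifyState
  split_ifs with h
  · exact sum_norm_sq_zeroKet _
  · simp only [norm_mul, mul_pow, ← mul_sum, sum_norm_sq_purifyAmp]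
    rw [norm_inv, Complex.norm_real, inv_pow, Real.norm_eq_abs, sq_abs,
      Real.sq_sqrt (G.fstProb_nonneg n s), inv_mul_cancel₀ h]

/-- This also covers outcomes of probability zero, since all their amplitudes vanish; later
arguments then need no case split. -/
theorem sqrt_fstProb_mul_purifyState (s : BitStr (G.fstLen n))
    (y : BitStr (G.sndLen n + G.junkLen n)) :
    ((Real.sqrt (G.fstProb n s) : ℝ) : ℂ) * G.purifyState n s y = G.purifyAmp n s y := by
  unfold purifyState
  split_ifs with h
  · have h0 := G.sum_norm_sq_purifyAmp n s
    rw [h, sum_eq_zero_iff_of_nonneg fun _ _ => sq_nonneg _] at h0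
    have := h0 y (mem_univ y)
    rw [h, Real.sqrt_zero, Complex.ofReal_zero, zero_mul]
    exact (norm_eq_zero.1 (pow_eq_zero_iff two_ne_zero |>.1 this)).symm
  · have h1 : ((Real.sqrt (G.fstProb n s) : ℝ) : ℂ) ≠ 0 := by
      rw [Complex.ofReal_ne_zero]
      exact (Real.sqrt_ne_zero (G.fstProb_nonneg n s)).2 h
    rw [mul_inv_cancel_left₀ h1]

theorem ofReal_sqrt_mul_self {p : ℝ} (hp : 0 ≤ p) :
    ((Real.sqrt p : ℝ) : ℂ) * ((Real.sqrt p : ℝ) : ℂ) = p := by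
  rw [← Complex.ofReal_mul, Real.mul_self_sqrt hp]

theorem fstProb_smul_purifyState (s : BitStr (G.fstLen n)) :
    (G.fstProb n s : ℂ) • Matrix.vecMulVec (G.purifyState n s) (star (G.purifyState n s)) =
      Matrix.vecMulVec (G.purifyAmp n s) (star (G.purifyAmp n s)) := by
  ext y y'
  simp only [Matrix.smul_apply, Matrix.vecMulVec_apply, Pi.star_apply, smul_eq_mul,
    ← sqrt_fstProb_mul_purifyState, star_mul', Complex.star_def, Complex.conj_ofReal]
  rw [← ofReal_sqrt_mul_self (G.fstProb_nonneg n s)]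
  ring

end QPTGenerator

/-! ### Overlaps -/

/-- Here `ρ` is the sum over `z` of the projectors `|a_z⟩⟨a_z|`, unnormalised, and each contributes
`|⟨ψ|a_z⟩|²` to the trace. -/
theorem overlap_eq_sum_norm_sq {N : ℕ} {D : Type*} [Fintype D] (ψ : Ket N) (ρ : QOp N)
    (a : BitStr N → D → ℂ) (hρ : ∀ y y', ρ y y' = ∑ z, a y z * star (a y' z)) :
    overlap ψ ρ = ∑ z, ‖∑ y, star (ψ y) * a y z‖ ^ 2 := by
  have h : Matrix.trace (Matrix.vecMulVec ψ (star ψ) * ρ) =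
      ((∑ z, ‖∑ y, star (ψ y) * a y z‖ ^ 2 : ℝ) : ℂ) := by
    push_cast
    simp only [← Complex.mul_conj', map_sum, sum_mul_sum]
    simp only [Matrix.trace, Matrix.diag_apply, Matrix.mul_apply, Matrix.vecMulVec_apply,
      Pi.star_apply, mul_sum, map_mul, Complex.star_def, Complex.conj_conj, hρ]
    rw [sum_comm, sum_comm_cycle]
    refine sum_congr rfl fun z _ => sum_congr rfl fun i _ => sum_congr rfl fun j _ => ?_
    ring
  rw [overlap, h, Complex.ofReal_re]

theorem norm_sum_star_mul_sq_le {Y : Type*} (S : Finset Y) (v a : Y → ℂ) :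
    ‖∑ y ∈ S, star (v y) * a y‖ ^ 2 ≤ (∑ y ∈ S, ‖v y‖ ^ 2) * ∑ y ∈ S, ‖a y‖ ^ 2 := by
  refine le_trans ?_ (sum_mul_sq_le_sq_mul_sq S (fun y => ‖v y‖) fun y => ‖a y‖)
  gcongr
  refine (norm_sum_le _ _).trans_eq ?_
  simp

/-- If `v` is concentrated on the good event `P`, then a family `a` overlapping with `v` has
noticeable weight on the good event. -/
theorem sum_norm_inner_sq_le {Y D : Type*} [Fintype Y] [Fintype D] (P : Y → Prop)
    [DecidablePred P] (v : Y → ℂ) (a : Y → D → ℂ) (ha : ∑ y, ∑ z, ‖a y z‖ ^ 2 ≤ 1) :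
    ∑ z, ‖∑ y, star (v y) * a y z‖ ^ 2 ≤
      2 * ((∑ y, ‖v y‖ ^ 2) * ∑ y with P y, ∑ z, ‖a y z‖ ^ 2) +
        2 * ∑ y with ¬ P y, ‖v y‖ ^ 2 := by
  -- Cauchy–Schwarz is relaxed differently on the two parts: on `P` the mass of `v` is enlarged to
  -- its total, off `P` that of `a` is, to be bounded by `ha` after summing over `z`.
  have hpoint (z : D) : ‖∑ y, star (v y) * a y z‖ ^ 2 ≤
      2 * ((∑ y, ‖v y‖ ^ 2) * ∑ y with P y, ‖a y z‖ ^ 2) +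
        2 * ((∑ y with ¬ P y, ‖v y‖ ^ 2) * ∑ y, ‖a y z‖ ^ 2) := by
    rw [← sum_filter_add_sum_filter_not univ P fun y => star (v y) * a y z]
    have h₁ := norm_sum_star_mul_sq_le (univ.filter P) v fun y => a y z
    have h₂ := norm_sum_star_mul_sq_le (univ.filter fun y => ¬ P y) v fun y => a y z
    have h₃ : (∑ y with P y, ‖v y‖ ^ 2) * ∑ y with P y, ‖a y z‖ ^ 2 ≤
        (∑ y, ‖v y‖ ^ 2) * ∑ y with P y, ‖a y z‖ ^ 2 :=
      mul_le_mul_of_nonneg_right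
        (sum_le_sum_of_subset_of_nonneg (filter_subset _ _) fun _ _ _ => sq_nonneg _)
        (sum_nonneg fun _ _ => sq_nonneg _)
    have h₄ : (∑ y with ¬ P y, ‖v y‖ ^ 2) * ∑ y with ¬ P y, ‖a y z‖ ^ 2 ≤
        (∑ y with ¬ P y, ‖v y‖ ^ 2) * ∑ y, ‖a y z‖ ^ 2 :=
      mul_le_mul_of_nonneg_left
        (sum_le_sum_of_subset_of_nonneg (filter_subset _ _) fun _ _ _ => sq_nonneg _)
        (sum_nonneg fun _ _ => sq_nonneg _)
    have h₅ := pow_le_pow_left₀ (norm_nonneg _) (norm_add_le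
      (∑ y with P y, star (v y) * a y z) (∑ y with ¬ P y, star (v y) * a y z)) 2
    have h₆ := add_sq_le (a := ‖∑ y with P y, star (v y) * a y z‖)
      (b := ‖∑ y with ¬ P y, star (v y) * a y z‖)
    linarith
  refine (sum_le_sum fun z _ => hpoint z).trans ?_
  rw [sum_add_distrib, ← mul_sum, ← mul_sum, ← mul_sum, ← mul_sum, sum_comm,
    sum_comm (s := (univ : Finset D))]
  have := mul_le_mul_of_nonneg_left ha
    (sum_nonneg fun y (_ : y ∈ univ.filter fun y => ¬ P y) => sq_nonneg ‖v y‖)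
  linarith

namespace QPTGenerator

variable (G : QPTGenerator) (n : ℕ)

/-- The weight of `s` cancels the normalisation of the state, leaving the raw amplitudes. -/
theorem fstProb_mul_overlap {D : Type*} [Fintype D] (s : BitStr (G.fstLen n))
    (ρ : QOp (G.sndLen n + G.junkLen n)) (a : BitStr (G.sndLen n + G.junkLen n) → D → ℂ)
    (hρ : ∀ y y', ρ y y' = ∑ z, a y z * star (a y' z)) :
    G.fstProb n s * overlap (G.purifyState n s) ρ =
      ∑ z, ‖∑ y, star (G.purifyAmp n s y) * a y z‖ ^ 2 := by
  rw [overlap_eq_sum_norm_sq _ ρ a hρ, mul_sum]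
  refine sum_congr rfl fun z _ => ?_
  simp only [← sqrt_fstProb_mul_purifyState, star_mul', mul_assoc, ← mul_sum]
  rw [norm_mul, mul_pow, norm_star, Complex.norm_real, Real.norm_eq_abs, sq_abs,
    Real.sq_sqrt (G.fstProb_nonneg n s)]

end QPTGenerator

/-! ### The reduction -/

namespace PolySizeAdversary

theorem sum_norm_sq_amp {inLen outLen : ℕ → ℕ} (A : PolySizeAdversary inLen outLen)
    (τ : AdviceEnsemble A.adviceLen) (n : ℕ) (s : BitStr (inLen n)) :
    ∑ y, ∑ z, ‖A.amp τ n s y z‖ ^ 2 = 1 := by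
  have h : ∑ y, ‖τ.ket n y‖ ^ 2 = 1 := τ.isState n
  rw [← h, ← sum_norm_sq_inputKet (c := A.ancillaLen n) s (τ.ket n),
    ← (A.circuit n).sum_norm_sq_run, sum_append_cast (A.width_eq n)]
  rfl

theorem outputProb_eq {inLen outLen : ℕ → ℕ} (A : PolySizeAdversary inLen outLen)
    (τ : AdviceEnsemble A.adviceLen) (n : ℕ) (s : BitStr (inLen n)) (y : BitStr (outLen n)) :
    A.outputProb τ n s y = ∑ z, ‖A.amp τ n s y z‖ ^ 2 := by
  simp only [outputProb, output, Complex.star_def, Complex.mul_conj', Complex.re_sum]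
  norm_cast

/-- The adversary that discards the last part of its output. -/
def truncate {inLen outLen restLen : ℕ → ℕ}
    (A : PolySizeAdversary inLen fun n => outLen n + restLen n) :
    PolySizeAdversary inLen outLen where
  adviceLen := A.adviceLen
  ancillaLen := A.ancillaLen
  discardLen n := restLen n + A.discardLen n
  width_eq n := by rw [A.width_eq n, add_assoc]
  circuit := A.circuit
  poly_size := A.poly_size

theorem truncate_outputProb {inLen outLen restLen : ℕ → ℕ}
    (A : PolySizeAdversary inLen fun n => outLen n + restLen n)
    (τ : AdviceEnsemble A.adviceLen) (n : ℕ) (s : BitStr (inLen n)) (k : BitStr (outLen n)) :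
    A.truncate.outputProb τ n s k = ∑ j, ∑ z, ‖A.amp τ n s (Fin.append k j) z‖ ^ 2 := by
  refine (outputProb_eq A.truncate τ n s k).trans ?_
  refine (sum_append (a := restLen n) (b := A.discardLen n) _).trans ?_
  refine sum_congr rfl fun j _ => sum_congr rfl fun z _ => ?_
  have h : Fin.append k (Fin.append j z) ∘ Fin.cast (A.truncate.width_eq n) =
      Fin.append (Fin.append k j) z ∘ Fin.cast (A.width_eq n) := by
    rw [Fin.append_assoc k j z]
    rfl
  exact congrArg (fun x => ‖(A.circuit n).run (inputKet s (τ.ket n)) x‖ ^ 2) h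

end PolySizeAdversary

/-- The good event is that the key part of `y` is accepted by `V`. Its weight in the adversary's
output is the success probability of `truncate`; the complementary mass of the amplitudes is the
correctness loss at `s`. -/
theorem QPTGenerator.fstProb_mul_overlap_le (G : QPTGenerator) (n : ℕ)
    (A : PolySizeAdversary G.fstLen fun n => G.sndLen n + G.junkLen n)
    (τ : AdviceEnsemble A.adviceLen) (s : BitStr (G.fstLen n)) (V : BitStr (G.sndLen n) → Bool) :
    G.fstProb n s * overlap (G.purifyState n s) (A.output τ n s) ≤
      2 * (G.fstProb n s * ∑ k, if V k = true then A.truncate.outputProb τ n s k else 0) +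
        2 * (G.fstProb n s - ∑ k, if V k = true then G.jointProb n s k else 0) := by
  have hmain := sum_norm_inner_sq_le
    (fun y : BitStr (G.sndLen n + G.junkLen n) => V (fun i => y (Fin.castAdd _ i)) = true)
    (G.purifyAmp n s) (A.amp τ n s) (A.sum_norm_sq_amp τ n s).le
  have hbad := sum_filter_add_sum_filter_not univ
    (fun y : BitStr (G.sndLen n + G.junkLen n) => V (fun i => y (Fin.castAdd _ i)) = true)
    fun y => ‖G.purifyAmp n s y‖ ^ 2
  have hgood (f : BitStr (G.sndLen n + G.junkLen n) → ℝ) :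
      ∑ y with V (fun i => y (Fin.castAdd _ i)) = true, f y =
        ∑ k, if V k = true then ∑ j, f (Fin.append k j) else 0 := by
    rw [sum_filter, sum_append]
    refine sum_congr rfl fun k _ => ?_
    simp only [Fin.append_left]
    split_ifs <;> simp
  rw [← G.fstProb_mul_overlap n s (A.output τ n s) _ fun _ _ => rfl, hgood, sum_norm_sq_purifyAmp] at hmain
  rw [hgood, sum_norm_sq_purifyAmp] at hbad
  simp only [purifyAmp_append] at hbad
  simp only [PolySizeAdversary.truncate_outputProb]
  change _ ≤ _ + 2 * (_ - ∑ k, if V k = true then ∑ z, ‖G.amp n s k z‖ ^ 2 else 0)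
  refine hmain.trans_eq ?_
  linarith

theorem IsOneWayPuzzle.isStatePuzzle_purify {Samp : QPTGenerator}
    {Ver : ∀ n, BitStr (Samp.fstLen n) → BitStr (Samp.sndLen n) → Bool}
    (h : IsOneWayPuzzle Samp Ver) : IsStatePuzzle Samp.purify Samp.purifyState where
  isState := Samp.purifyState_isState
  output_eq n s := by
    rw [Samp.purify_fstProb n s, Samp.purify_residual n s]
    exact (Samp.fstProb_smul_purifyState n s).symm
  secure A τ := by
    -- The output length of `A` unfolds to key plus junk, the form that `truncate` expects.
    let B : PolySizeAdversary Samp.fstLen fun n => Samp.sndLen n + Samp.junkLen n := A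
    refine (h.secure B.truncate τ).of_le_two_mul_add h.correct fun n => ?_
    have hsum := sum_le_sum fun (s : BitStr (Samp.fstLen n)) (_ : s ∈ univ) =>
      Samp.fstProb_mul_overlap_le n B τ s (Ver n s)
    -- Since the outcome probabilities sum to one, the losses at the various `s` add up to the
    -- correctness error.
    rw [sum_add_distrib, ← mul_sum, ← mul_sum, sum_sub_distrib, Samp.sum_fstProb] at hsum
    refine le_of_eq_of_le (sum_congr rfl fun s _ => ?_) hsum
    rw [Samp.purify_fstProb n s]
    rfl

end QCrypt

theorem mainTheorem6
    (h : ∃ (Samp : QCrypt.QPTGenerator)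
      (Ver : ∀ n, QCrypt.BitStr (Samp.fstLen n) → QCrypt.BitStr (Samp.sndLen n) → Bool),
      QCrypt.IsOneWayPuzzle Samp Ver) :
    ∃ (G : QCrypt.QPTGenerator)
      (ψ : ∀ n, QCrypt.BitStr (G.fstLen n) → QCrypt.Ket (G.sndLen n)),
      QCrypt.IsStatePuzzle G ψ := by
  obtain ⟨Samp, Ver, h⟩ := h
  exact ⟨Samp.purify, Samp.purifyState, h.isStatePuzzle_purify⟩
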